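/- Let $n,k,r$ be integers with $k\ge 1$, $n\ge 2k+1$ and $r\ge 2$. Put $\Omega=\{1,\dots,n+k(r-2)\}$ and $I=\{1,\dots,r\}$. Let $\Gamma=\Gamma(KG(n,k),r)$ be the incidence system with type set $I$ whose elements of type $i\in I$ are the pairs $(i,A)$ with $A$ a $k$-subset of $\Omega$, two distinct elements $(i,A)$ and $(j,B)$ being incident if and only if $i\ne j$ and $A\cap B=\emptyset$ (and every element being incident to itself). A flag is a set $F$ of pairwise incident elements; its type $t(F)$ is the set of types of its elements, and a chamber is a flag of type $I$. The residue of $F$ consists of the elements outside $F$ that are incident to all elements of $F$; its type is $I\setminus t(F)$ and its rank is $|I\setminus t(F)|$. An incidence system is a geometry if every flag lies in a chamber; it is firm (resp. thick) if every residue of rank one has at least two (resp. three) elements; it is residually connected if every residue of rank at least two has a connected incidence graph. An automorphism is a bijection $\alpha$ of the elements inducing a bijection of the types such that $x,y$ are incident if and only if $\alpha(x),\alpha(y)$ are; $\mathrm{Aut}(\Gamma)$ is the group of all automorphisms and $\mathrm{Aut}_I(\Gamma)$ the subgroup of those preserving the type of every element. $\Gamma$ is flag-transitive if for every $J\subseteq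 I$ the group $\mathrm{Aut}_I(\Gamma)$ is transitive on the flags of type $J$. The Buekenhout diagram of $\Gamma$ is the graph on $I$ in which $i\neq j$ are joined when no residue of type $\{i,j\}$ is a generalised digon (a system in which any two elements of different types are incident). The edge $\{i,j\}$ has label $d_{ij}-g_{ij}-d_{ji}$, where $g_{ij}$ is half the girth of the incidence graph of a residue of type $\{i,j\}$ and $d_{ij}$ is the longest distance in that graph from an element of type $i$ to any element. The vertex $i$ carries its order $s_i$, the size of a residue of type $\{i\}$ minus one, and the number $n_i$ of elements of type $i$. **Theorem.** $\Gamma(KG(n,k),r)$ is a firm, residually connected and flag-transitive incidence geometry of rank $r$, and it is thick unless $(n,k)=(3,1)$. Moreover $\mathrm{Aut}_I(\Gamma)\cong S_\Omega$ and $\mathrm{Aut}(\Gamma)\cong S_\Omega\times S_r$, where $S_\Omega$ is the symmetric group on $\Omega$. The Buekenhout diagram of $\Gamma$ is the complete graph on $I$; all orders are $s_i=\binom{n-k}{k}-1$; the number of elements of each type is $n_i=\binom{n+k(r-2)}{k}$; and each edge is labelled $d-g-d$, where $g=3$ if $n=2k+1$ and $g=2$ otherwise, and $d=2\left\lceil\frac{k}{n-2k}\right\rceil+1$.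 -/

import Mathlib

universe u v

/-- An incidence system with set of elements `X` and set of types `I`. -/
structure IncidenceSystem (X : Type u) (I : Type v) where
  /-- the type function -/
  typ : X → I
  /-- the incidence relation -/
  inc : X → X → Prop
  inc_refl : ∀ x, inc x x
  inc_symm : ∀ x y, inc x y → inc y x
  eq_of_inc : ∀ x y, inc x y → typ x = typ y → x = y

namespace IncidenceSystem

variable {X : Type u} {I : Type v} (S : IncidenceSystem X I)

/-- The rank is the number of types. -/
noncomputable def rank (_S : IncidenceSystem X I) : ℕ∞ := ENat.card I

/-- The incidence graph, without loops. -/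
def incidenceGraph : SimpleGraph X where
  Adj x y := x ≠ y ∧ S.inc x y
  symm := ⟨fun x y h => ⟨h.1.symm, S.inc_symm x y h.2⟩⟩
  loopless := ⟨fun _ h => h.1 rfl⟩

/-- A flag is a set of pairwise incident elements. -/
def IsFlag (F : Set X) : Prop := ∀ x ∈ F, ∀ y ∈ F, S.inc x y

/-- The type of a flag. -/
def flagType (F : Set X) : Set I := S.typ '' F

/-- A chamber is a flag of type `I`. -/
def IsChamber (C : Set X) : Prop := S.IsFlag C ∧ S.flagType C = Set.univ

/-- An incidence geometry: every flag is contained in a chamber. -/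
def IsGeometry : Prop := ∀ F : Set X, S.IsFlag F → ∃ C : Set X, S.IsChamber C ∧ F ⊆ C

/-- The elements of the residue of `F`: those incident to all of `F` and not in `F`. -/
def residueElems (F : Set X) : Set X := {x | (∀ y ∈ F, S.inc x y) ∧ x ∉ F}

/-- The types of the residue of `F`. -/
def residueTypes (F : Set X) : Set I := (S.flagType F)ᶜ

/-- The residue of `F`, with the restricted type function and incidence. -/
def residue (F : Set X) : IncidenceSystem (S.residueElems F) (S.residueTypes F) where
  typ x := ⟨S.typ x.1, by
    rintro ⟨y, hy, hxy⟩
    exact x.2.2 (S.eq_of_inc x.1 y (x.2.1 y hy) hxy.symm ▸ hy)⟩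
  inc x y := S.inc x.1 y.1
  inc_refl x := S.inc_refl x.1
  inc_symm x y h := S.inc_symm x.1 y.1 h
  eq_of_inc x y h ht := Subtype.ext (S.eq_of_inc x.1 y.1 h (congrArg Subtype.val ht))

/-- Every residue of rank at least two has a connected incidence graph. -/
def IsResiduallyConnected : Prop :=
  ∀ F : Set X, S.IsFlag F → 2 ≤ (S.residue F).rank → (S.residue F).incidenceGraph.Connected

/-- Every residue of rank one has at least two elements. -/
def IsFirm : Prop :=
  ∀ F : Set X, S.IsFlag F → (S.residue F).rank = 1 → 2 ≤ (S.residueElems F).encard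

/-- Every residue of rank one has at least three elements. -/
def IsThick : Prop :=
  ∀ F : Set X, S.IsFlag F → (S.residue F).rank = 1 → 3 ≤ (S.residueElems F).encard

/-- `α` is an automorphism: a bijection on the elements that induces a bijection on the types,
and preserves and reflects incidence and equality of types. -/
def IsAutomorphism (α : Equiv.Perm X) : Prop :=
  (∃ β : Equiv.Perm I, ∀ x, S.typ (α x) = β (S.typ x)) ∧
  (∀ x y, S.inc x y ↔ S.inc (α x) (α y)) ∧
  (∀ x y, S.typ x = S.typ y ↔ S.typ (α x) = S.typ (α y))

/-- The automorphism group, under composition. -/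
def aut : Subgroup (Equiv.Perm X) where
  carrier := {α | S.IsAutomorphism α}
  one_mem' := ⟨⟨1, fun _ => rfl⟩, fun _ _ => Iff.rfl, fun _ _ => Iff.rfl⟩
  mul_mem' := by
    rintro a b ⟨⟨p, hp⟩, ha, ha'⟩ ⟨⟨q, hq⟩, hb, hb'⟩
    refine ⟨⟨p * q, fun x => ?_⟩, fun x y => ?_, fun x y => ?_⟩
    · simp [hp, hq]
    · exact (hb x y).trans (ha (b x) (b y))
    · exact (hb' x y).trans (ha' (b x) (b y))
  inv_mem' := by
    rintro a ⟨⟨p, hp⟩, ha, ha'⟩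
    refine ⟨⟨p⁻¹, fun x => ?_⟩, fun x y => ?_, fun x y => ?_⟩
    · rw [Equiv.Perm.eq_inv_iff_eq, ← hp]; simp
    · simpa using (ha (a⁻¹ x) (a⁻¹ y)).symm
    · simpa using (ha' (a⁻¹ x) (a⁻¹ y)).symm

/-- The group of type-preserving automorphisms. -/
def autI : Subgroup (Equiv.Perm X) where
  carrier := {α | α ∈ S.aut ∧ ∀ x, S.typ (α x) = S.typ x}
  one_mem' := ⟨S.aut.one_mem, fun _ => rfl⟩
  mul_mem' := by
    rintro a b ⟨ha, ha'⟩ ⟨hb, hb'⟩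
    exact ⟨S.aut.mul_mem ha hb, fun x => (ha' (b x)).trans (hb' x)⟩
  inv_mem' := by
    rintro a ⟨ha, ha'⟩
    refine ⟨S.aut.inv_mem ha, fun x => ?_⟩
    simpa using (ha' (a⁻¹ x)).symm

/-- `Aut_I` is transitive on the flags of type `J`, for each set of types `J`. -/
def IsFlagTransitive : Prop :=
  ∀ (J : Set I) (F G : Set X), S.IsFlag F → S.IsFlag G → S.flagType F = J → S.flagType G = J →
    ∃ α ∈ S.autI, α '' F = G

/-- Any two elements of distinct types are incident (used for systems of rank two). -/
def IsGeneralizedDigon : Prop := ∀ x y, S.typ x ≠ S.typ y → S.inc x y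

/-- The `i`-diameter of the residue of `F`: the longest distance, in the incidence graph of the
residue, from an element of type `i` to any element. -/
noncomputable def residueDiameter (F : Set X) (i : I) : ℕ∞ :=
  ⨆ x : S.residueElems F, ⨆ _ : S.typ x = i, ⨆ y : S.residueElems F,
    (S.residue F).incidenceGraph.edist x y

/-- The data carried by a Buekenhout diagram on the set `I` of types. -/
structure DiagramData (I : Type v) where
  /-- the underlying graph -/
  graph : SimpleGraph I
  /-- the gonalities `g i j` -/
  gonality : I → I → ℕ
  /-- the diameters: `diameter i j` is the `i`-diameter of a residue of type `{i, j}` -/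
  diameter : I → I → ℕ
  /-- the orders `s i` -/
  order : I → ℕ
  /-- the numbers `n i` of elements of each type -/
  count : I → ℕ

/-- `D` is the Buekenhout diagram of `S` (meant for firm, residually connected, flag-transitive
geometries; then residues of all types exist, and those of the same type are isomorphic). -/
structure IsBuekenhoutDiagram (D : DiagramData I) : Prop where
  adj_iff : ∀ i j, D.graph.Adj i j ↔ i ≠ j ∧
    ∀ F, S.IsFlag F → S.residueTypes F = {i, j} → ¬ (S.residue F).IsGeneralizedDigon
  /-- the girth of the incidence graph of a residue of type `{i, j}` is twice the gonality -/
  girth_eq : ∀ i j, D.graph.Adj i j → ∀ F, S.IsFlag F → S.residueTypes F = {i, j} →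
    (S.residue F).incidenceGraph.egirth = 2 * (D.gonality i j : ℕ∞)
  diameter_eq : ∀ i j, D.graph.Adj i j → ∀ F, S.IsFlag F → S.residueTypes F = {i, j} →
    S.residueDiameter F i = (D.diameter i j : ℕ∞)
  /-- the size of a residue of type `{i}` is the `i`-order plus one -/
  order_eq : ∀ i, ∀ F, S.IsFlag F → S.residueTypes F = {i} →
    (S.residueElems F).encard = (D.order i : ℕ∞) + 1
  count_eq : ∀ i, {x | S.typ x = i}.encard = (D.count i : ℕ∞)

end IncidenceSystem

/-- The set `Ω` of `n + k (r - 2)` points (used for `r ≥ 2`). -/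
abbrev KneserPoints (n k r : ℕ) : Type := Fin (n + k * (r - 2))

/-- The elements of `Γ(KG(n,k),r)`: `r` copies of the set of all `k`-subsets of `Ω`. -/
abbrev KneserElem (n k r : ℕ) : Type :=
  Fin r × {A : Finset (KneserPoints n k r) // A.card = k}

/-- The incidence system `Γ(KG(n,k),r)`. Distinct elements are incident when they have distinct
types and are disjoint as subsets of `Ω`; every element is incident to itself. -/
def kneserGeometry (n k r : ℕ) : IncidenceSystem (KneserElem n k r) (Fin r) where
  typ x := x.1
  inc x y := x = y ∨ (x.1 ≠ y.1 ∧ Disjoint x.2.1 y.2.1)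
  inc_refl _ := Or.inl rfl
  inc_symm := by
    rintro x y (h | ⟨h, h'⟩)
    · exact Or.inl h.symm
    · exact Or.inr ⟨h.symm, h'.symm⟩
  eq_of_inc := by
    rintro x y (h | ⟨h, _⟩) ht
    · exact h
    · exact absurd ht h

/-! Flags missing ρ types leave exactly n + k(ρ - 2) points uncovered, and the residue is ρ copies
of the k-subsets of this free set. Local statements are therefore counts of free points
(`card_freePoints`): ρ disjoint blocks always fit, rank-one residues have choose(n - k, k) elements,
and rank-two residues are the bipartite double of the Kneser graph on n points.

Put d = n - 2k. In that double a walk of length two replaces at most d points of a k-set, and every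
such replacement occurs (`edist_le_even`, `walk_length`). The farthest pair is one k-set taken in
both types, which gives the diameter. A 4-cycle needs two disjoint sets of more than k points, so it
exists exactly when n ≥ 2k + 2; for n = 2k + 1 there is a hexagon.

A type-preserving automorphism is a family of permutations of the k-subsets, any two of which
jointly preserve disjointness. Counting the k-sets disjoint from three given ones shows that small
unions keep their size. Hence the k-sets through a common (k - 1)-set are sent to k-sets through a
common (k - 1)-set, the permutations descend to (k - 1)-subsets, and induction down to k = 1 yields
a permutation of Ω (`IsKneserPair.exists_perm`). -/

open Finset

/-- The `k`-subsets of `Ω`. -/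
abbrev KSubset (Ω : Type*) (k : ℕ) : Type _ := {A : Finset Ω // A.card = k}

/-- By Pascal's rule x ↦ choose(x, k) increases strictly once the larger argument is at least k, so
bounding only one of the two arguments suffices. -/
theorem Nat.choose_left_injOn {k x y : ℕ} (hk : 1 ≤ k) (hx : k ≤ x)
    (h : x.choose k = y.choose k) : x = y := by
  have key : ∀ {a b : ℕ}, k ≤ b → a < b → a.choose k < b.choose k := by
    intro a b hb hab
    obtain ⟨b, rfl⟩ : ∃ c, b = c + 1 := ⟨b - 1, by omega⟩
    obtain ⟨l, rfl⟩ : ∃ c, k = c + 1 := ⟨k - 1, by omega⟩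
    have h1 : a.choose (l + 1) ≤ b.choose (l + 1) := Nat.choose_le_choose _ (by omega)
    have h2 : 0 < b.choose l := Nat.choose_pos (by omega)
    have h3 : (b + 1).choose (l + 1) = _ := Nat.choose_succ_succ' b l
    omega
  rcases lt_trichotomy x y with h' | h' | h'
  · exact absurd h (key (by omega) h').ne
  · exact h'
  · exact absurd h.symm (key hx h').ne

/-! ### Permutations of k-subsets that preserve disjointness -/

section KneserPairs

variable {Ω : Type*} {k : ℕ}

/-- A pair of permutations of the `k`-subsets preserving and reflecting disjointness. -/
def IsKneserPair (f g : Equiv.Perm (KSubset Ω k)) : Prop :=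
  ∀ A B, Disjoint A.1 B.1 ↔ Disjoint (f A).1 (g B).1

theorem IsKneserPair.inv {f g : Equiv.Perm (KSubset Ω k)} (h : IsKneserPair f g) :
    IsKneserPair f⁻¹ g⁻¹ := fun A B => by
  simpa using (h (f⁻¹ A) (g⁻¹ B)).symm

theorem IsKneserPair.swap {f g : Equiv.Perm (KSubset Ω k)} (h : IsKneserPair f g) :
    IsKneserPair g f := fun A B => by
  simpa [disjoint_comm] using h B A

variable [DecidableEq Ω]

/-- Sets of size k meeting pairwise in k - 1 points either lie in one (k + 1)-set or share a (k -
1)-set. Here Z has a point z outside X ∪ Y, and Z without z must equal X ∩ Z, Y ∩ Z and X ∩ Y. -/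
theorem Finset.inter_subset_of_card_union {X Y Z : Finset Ω} (hX : #X = k) (hY : #Y = k)
    (hZ : #Z = k) (hXY : #(X ∪ Y) = k + 1) (hXZ : #(X ∪ Z) = k + 1) (hYZ : #(Y ∪ Z) = k + 1)
    (h : #(X ∪ Y ∪ Z) ≠ k + 1) : X ∩ Y ⊆ Z := by
  have h1 := card_union_add_card_inter X Y
  have h2 := card_union_add_card_inter X Z
  have h3 := card_union_add_card_inter Y Z
  have hz : ¬ Z ⊆ X ∪ Y := fun hz => h (by rw [union_eq_left.2 hz, hXY])
  obtain ⟨z, hz, hz'⟩ := not_subset.1 hz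
  simp only [mem_union, not_or] at hz'
  have h4 := card_erase_of_mem hz
  have e1 : X ∩ Z = Z.erase z := by
    refine eq_of_subset_of_card_le (fun x hx => ?_) (by omega)
    rw [mem_inter] at hx
    exact mem_erase.2 ⟨fun e => hz'.1 (e ▸ hx.1), hx.2⟩
  have e2 : Y ∩ Z = Z.erase z := by
    refine eq_of_subset_of_card_le (fun x hx => ?_) (by omega)
    rw [mem_inter] at hx
    exact mem_erase.2 ⟨fun e => hz'.2 (e ▸ hx.1), hx.2⟩
  have e3 : Z.erase z = X ∩ Y := by
    refine eq_of_subset_of_card_le (subset_inter ?_ ?_) (by omega)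
    · rw [← e1]; exact inter_subset_left
    · rw [← e2]; exact inter_subset_left
  rw [← e3]
  exact erase_subset _ _

theorem KSubset.card_union_of_ne {S : KSubset Ω k} {A B : KSubset Ω (k + 1)} (hA : S.1 ⊆ A.1)
    (hB : S.1 ⊆ B.1) (hAB : A ≠ B) : #(A.1 ∪ B.1) = k + 2 ∧ A.1 ∩ B.1 = S.1 := by
  have h1 : #S.1 ≤ #(A.1 ∩ B.1) := card_le_card (subset_inter hA hB)
  have h2 : #(A.1 ∩ B.1) < k + 1 := by
    by_contra h
    have e1 : A.1 ∩ B.1 = A.1 := eq_of_subset_of_card_le inter_subset_left (by rw [A.2]; omega)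
    have e2 : A.1 ∩ B.1 = B.1 := eq_of_subset_of_card_le inter_subset_right (by rw [B.2]; omega)
    exact hAB (Subtype.ext (e1.symm.trans e2))
  have h3 := card_union_add_card_inter A.1 B.1
  rw [A.2, B.2] at h3
  rw [S.2] at h1
  refine ⟨by omega, (eq_of_subset_of_card_le (subset_inter hA hB) (by rw [S.2]; omega)).symm⟩

variable [Fintype Ω]

theorem KSubset.card_filter_subset (U : Finset Ω) :
    #{D : KSubset Ω k | D.1 ⊆ U} = U.card.choose k := by
  rw [← Finset.card_powersetCard, ← Finset.card_map (Function.Embedding.subtype _)]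
  congr 1
  ext D
  simp only [mem_map, mem_filter, mem_univ, true_and, Function.Embedding.subtype_apply,
    mem_powersetCard]
  exact ⟨by rintro ⟨a, h, rfl⟩; exact ⟨h, a.2⟩, fun h => ⟨⟨D, h.2⟩, h.1, rfl⟩⟩

/-- Both sides count k-sets disjoint from three given ones, and `g` maps the first family onto the
second. -/
theorem IsKneserPair.choose_union {f g : Equiv.Perm (KSubset Ω k)} (h : IsKneserPair f g)
    (A B C : KSubset Ω k) :
    (#(A.1 ∪ B.1 ∪ C.1)ᶜ).choose k = (#((f A).1 ∪ (f B).1 ∪ (f C).1)ᶜ).choose k := by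
  rw [← KSubset.card_filter_subset, ← KSubset.card_filter_subset]
  refine Finset.card_equiv g fun D => ?_
  simp only [mem_filter, mem_univ, true_and, subset_compl_iff_disjoint_left,
    disjoint_union_left, h _ D]

/-- The bound on `m` leaves a complement of at least k points, the range in which its binomial
coefficient determines its size. -/
theorem IsKneserPair.card_union {f g : Equiv.Perm (KSubset Ω k)} (h : IsKneserPair f g)
    (hk : 1 ≤ k) (A B C : KSubset Ω k) {m : ℕ} (hm : m + k ≤ Fintype.card Ω) :
    #(A.1 ∪ B.1 ∪ C.1) = m ↔ #((f A).1 ∪ (f B).1 ∪ (f C).1) = m := by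
  have key := h.choose_union A B C
  have h1 := card_compl_add_card (A.1 ∪ B.1 ∪ C.1)
  have h2 := card_compl_add_card ((f A).1 ∪ (f B).1 ∪ (f C).1)
  constructor
  · intro hA
    have := Nat.choose_left_injOn hk (by omega) key
    omega
  · intro hA
    have := Nat.choose_left_injOn hk (by omega) key.symm
    omega

theorem KSubset.exists_pair_of_subset (S : KSubset Ω k) (hN : k + 2 ≤ Fintype.card Ω) :
    ∃ A B : KSubset Ω (k + 1), A.1 ∩ B.1 = S.1 ∧ #(A.1 ∪ B.1) = k + 2 := by
  have h1 : 1 < #(S.1ᶜ) := by rw [card_compl, S.2]; omega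
  obtain ⟨a, ha, b, hb, hab⟩ := one_lt_card.1 h1
  rw [mem_compl] at ha hb
  have hA : #(insert a S.1) = k + 1 := by rw [card_insert_of_notMem ha, S.2]
  have hB : #(insert b S.1) = k + 1 := by rw [card_insert_of_notMem hb, S.2]
  have hI : insert a S.1 ∩ insert b S.1 = S.1 := by
    ext x
    simp only [mem_inter, mem_insert]
    refine ⟨?_, fun h => ⟨Or.inr h, Or.inr h⟩⟩
    rintro ⟨rfl | h, h' | h'⟩ <;> first | assumption | exact absurd h' hab
  refine ⟨⟨_, hA⟩, ⟨_, hB⟩, hI, ?_⟩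
  have h2 := card_union_add_card_inter (insert a S.1) (insert b S.1)
  rw [hI, hA, hB, S.2] at h2
  simp only
  omega

/-- Take `A`, `B` meeting exactly in `S` and let `T` be the intersection of their images. Any
further `C` through `S` forms with them a triple of the kind sharing a k-set, and this kind is
visible in the sizes of unions. -/
theorem IsKneserPair.exists_pencil {f g : Equiv.Perm (KSubset Ω (k + 1))} (h : IsKneserPair f g)
    (hN : 2 * (k + 1) + 1 ≤ Fintype.card Ω) (S : KSubset Ω k) :
    ∃ T : KSubset Ω k, ∀ A, S.1 ⊆ A.1 → T.1 ⊆ (f A).1 := by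
  obtain ⟨A, B, hI, hU⟩ := S.exists_pair_of_subset (by omega)
  have hA : S.1 ⊆ A.1 := hI ▸ inter_subset_left
  have hB : S.1 ⊆ B.1 := hI ▸ inter_subset_right
  have two : ∀ C D : KSubset Ω (k + 1),
      #(C.1 ∪ D.1) = k + 2 → #((f C).1 ∪ (f D).1) = k + 2 := by
    intro C D hCD
    -- Repeating `D` turns the triple count into one for pairs. The condition (k + 2) + (k + 1) ≤
    -- |Ω| is exactly `hN`.
    have := (h.card_union (by omega) C D D (m := k + 2) (by omega)).1 (by
      rwa [union_assoc, union_self])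
    rwa [union_assoc, union_self] at this
  have hfU := two A B hU
  have hfI : #((f A).1 ∩ (f B).1) = k := by
    have := card_union_add_card_inter (f A).1 (f B).1
    rw [(f A).2, (f B).2] at this
    omega
  refine ⟨⟨_, hfI⟩, fun C hC => ?_⟩
  rcases eq_or_ne A C with rfl | hAC
  · exact inter_subset_left
  rcases eq_or_ne B C with rfl | hBC
  · exact inter_subset_right
  have hAC' := KSubset.card_union_of_ne hA hC hAC
  have hBC' := KSubset.card_union_of_ne hB hC hBC
  refine inter_subset_of_card_union (f A).2 (f B).2 (f C).2 hfU (two _ _ hAC'.1) (two _ _ hBC'.1) ?_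
  intro h3
  have h4 := (h.card_union (by omega) A B C (m := k + 2) (by omega)).2 h3
  have h5 : A.1 ∪ B.1 = A.1 ∪ B.1 ∪ C.1 :=
    eq_of_subset_of_card_le subset_union_left (by omega)
  -- A point of `C` would lie in `A` or `B`, hence in `A ∩ C` or `B ∩ C`, both equal to `S`.
  have h6 : C.1 ⊆ S.1 := by
    intro x hx
    have : x ∈ A.1 ∪ B.1 := by rw [h5]; exact mem_union_right _ hx
    rcases mem_union.1 this with hx' | hx'
    · rw [← hAC'.2]; exact mem_inter.2 ⟨hx', hx⟩
    · rw [← hBC'.2]; exact mem_inter.2 ⟨hx', hx⟩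
  have := card_le_card h6
  rw [C.2, S.2] at this
  omega

theorem KSubset.eq_of_forall_subset {S T : KSubset Ω k} (hN : k + 2 ≤ Fintype.card Ω)
    (h : ∀ A : KSubset Ω (k + 1), S.1 ⊆ A.1 → T.1 ⊆ A.1) : T = S := by
  obtain ⟨A, B, hI, -⟩ := S.exists_pair_of_subset hN
  refine Subtype.ext (eq_of_subset_of_card_le ?_ (by rw [S.2, T.2]))
  rw [← hI]
  exact subset_inter (h A (hI ▸ inter_subset_left)) (h B (hI ▸ inter_subset_right))

/-- The pencil maps of `f` and `f⁻¹` are mutually inverse: going there and back gives a k-set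
contained in every member of the original pencil, hence its centre. -/
theorem IsKneserPair.exists_lower {f g : Equiv.Perm (KSubset Ω (k + 1))} (h : IsKneserPair f g)
    (hN : 2 * (k + 1) + 1 ≤ Fintype.card Ω) :
    ∃ f' : Equiv.Perm (KSubset Ω k), (∀ S A, S.1 ⊆ A.1 → (f' S).1 ⊆ (f A).1) ∧
      ∀ S A, S.1 ⊆ A.1 → (f'⁻¹ S).1 ⊆ (f⁻¹ A).1 := by
  choose u hu using h.exists_pencil hN
  choose v hv using h.inv.exists_pencil hN
  refine ⟨⟨u, v, fun S => ?_, fun S => ?_⟩, fun S A => hu S A, fun S A => hv S A⟩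
  · refine KSubset.eq_of_forall_subset (by omega) fun A hA => ?_
    simpa using hv _ _ (hu S A hA)
  · refine KSubset.eq_of_forall_subset (by omega) fun A hA => ?_
    simpa using hu _ _ (hv S A hA)

theorem KSubset.exists_disjoint_extend {S T : KSubset Ω k} (h : Disjoint S.1 T.1)
    (hN : 2 * (k + 1) ≤ Fintype.card Ω) :
    ∃ A B : KSubset Ω (k + 1), S.1 ⊆ A.1 ∧ T.1 ⊆ B.1 ∧ Disjoint A.1 B.1 := by
  have h1 : 1 < #((S.1 ∪ T.1)ᶜ) := by
    rw [card_compl, card_union_of_disjoint h, S.2, T.2]; omega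
  obtain ⟨a, ha, b, hb, hab⟩ := one_lt_card.1 h1
  simp only [mem_compl, mem_union, not_or] at ha hb
  refine ⟨⟨insert a S.1, by rw [card_insert_of_notMem ha.1, S.2]⟩,
    ⟨insert b T.1, by rw [card_insert_of_notMem hb.2, T.2]⟩,
    subset_insert _ _, subset_insert _ _, ?_⟩
  simp only [disjoint_insert_left, disjoint_insert_right, mem_insert, not_or]
  tauto

/-- Permutations preserving disjointness between `k`-subsets are induced by a permutation of the
points. -/
theorem IsKneserPair.exists_perm (hk : 1 ≤ k) (hN : 2 * k + 1 ≤ Fintype.card Ω)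
    {f g : Equiv.Perm (KSubset Ω k)} (h : IsKneserPair f g) :
    ∃ σ : Equiv.Perm Ω, ∀ A, (f A).1 = A.1.map σ.toEmbedding ∧ (g A).1 = A.1.map σ.toEmbedding := by
  induction k, hk using Nat.le_induction with
  | base =>
    -- Nonempty `A` is not disjoint from itself, so the singletons `f A` and `g A` meet and
    -- coincide.
    have hfg : ∀ A, f A = g A := by
      intro A
      by_contra hne
      have : Disjoint (f A).1 (g A).1 := by
        obtain ⟨a, ha⟩ := card_eq_one.1 (f A).2
        obtain ⟨b, hb⟩ := card_eq_one.1 (g A).2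
        rw [ha, hb, disjoint_singleton]
        rintro rfl
        exact hne (Subtype.ext (ha.trans hb.symm))
      rw [← h A A, disjoint_self, bot_eq_empty] at this
      have h2 := A.2
      rw [this] at h2
      simp at h2
    let e : Ω ≃ KSubset Ω 1 := Equiv.ofBijective (fun a => ⟨{a}, card_singleton a⟩) (by
      constructor
      · intro a b hab
        simpa using hab
      · intro A
        obtain ⟨a, ha⟩ := card_eq_one.1 A.2
        exact ⟨a, Subtype.ext ha.symm⟩)
    have he : ∀ a, (e a).1 = {a} := fun a => rfl
    refine ⟨(e.trans f).trans e.symm, fun A => ?_⟩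
    rw [← hfg, and_self]
    obtain ⟨a, rfl⟩ := e.surjective A
    rw [he, map_singleton, ← he]
    simp
  | succ k hk ih =>
    obtain ⟨f', hf, hf'⟩ := h.exists_lower hN
    obtain ⟨g', hg, hg'⟩ := h.swap.exists_lower hN
    -- Disjoint k-sets extend to disjoint (k + 1)-sets, whose images are disjoint and contain the
    -- images of the k-sets; the converse uses the inverses.
    have h' : IsKneserPair f' g' := by
      intro S T
      constructor
      · intro hST
        obtain ⟨A, B, hA, hB, hAB⟩ := KSubset.exists_disjoint_extend hST (by omega)
        exact disjoint_of_subset_left (hf _ _ hA) (disjoint_of_subset_right (hg _ _ hB)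
          ((h A B).1 hAB))
      · intro hST
        obtain ⟨A, B, hA, hB, hAB⟩ := KSubset.exists_disjoint_extend hST (by omega)
        have h1 := hf' _ _ hA
        have h2 := hg' _ _ hB
        simp only [Equiv.Perm.inv_def, Equiv.symm_apply_apply] at h1 h2
        exact disjoint_of_subset_left h1 (disjoint_of_subset_right h2 ((h.inv A B).1 hAB))
    obtain ⟨σ, hσ⟩ := ih (by omega) h'
    -- Each point of `A` lies in a k-subset of `A` since k ≥ 1, so `σ` maps `A` into its image;
    -- cardinalities agree.
    have key : ∀ (p : Equiv.Perm (KSubset Ω (k + 1))) (p' : Equiv.Perm (KSubset Ω k)),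
        (∀ S A, S.1 ⊆ A.1 → (p' S).1 ⊆ (p A).1) → (∀ S, (p' S).1 = S.1.map σ.toEmbedding) →
        ∀ A, (p A).1 = A.1.map σ.toEmbedding := by
      intro p p' hp hp' A
      refine (eq_of_subset_of_card_le (fun y hy => ?_) (by rw [card_map, A.2, (p A).2])).symm
      obtain ⟨x, hx, rfl⟩ := mem_map.1 hy
      obtain ⟨S, hS, hSc⟩ := exists_subsuperset_card_eq (n := k) (singleton_subset_iff.2 hx)
        (by simpa using hk) (by rw [A.2]; omega)
      refine hp ⟨S, hSc.2⟩ A hSc.1 ?_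
      rw [hp']
      exact mem_map_of_mem _ (singleton_subset_iff.1 hS)
    exact ⟨σ, fun A => ⟨key f f' hf (fun S => (hσ S).1) A, key g g' hg (fun S => (hσ S).2) A⟩⟩

end KneserPairs

/-! ### The action of point permutations on k-subsets -/

/-- Blockwise bijections glue to a bijection between the two unions, which extends to the finite set
Ω. -/
theorem KSubset.exists_perm_of_pairwise_disjoint {Ω ι : Type*} [Fintype Ω] {k : ℕ}
    {A B : ι → KSubset Ω k} (hA : Pairwise fun i j => Disjoint (A i).1 (A j).1)
    (hB : Pairwise fun i j => Disjoint (B i).1 (B j).1) :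
    ∃ σ : Equiv.Perm Ω, ∀ i, (A i).1.map σ.toEmbedding = (B i).1 := by
  classical
  have key : ∀ C : ι → KSubset Ω k, (Pairwise fun i j => Disjoint (C i).1 (C j).1) →
      Function.Bijective (fun x : (Σ i, (C i).1) => (⟨x.2.1, x.1, x.2.2⟩ : {a // ∃ i, a ∈ (C i).1})) := by
    intro C hC
    constructor
    · rintro ⟨i, a, ha⟩ ⟨j, b, hb⟩ h
      simp only [Subtype.mk.injEq] at h
      subst h
      obtain rfl : i = j := by
        by_contra hij
        exact disjoint_left.1 (hC hij) ha hb
      rfl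
    · rintro ⟨a, i, ha⟩
      exact ⟨⟨i, a, ha⟩, rfl⟩
  let EA := Equiv.ofBijective _ (key A hA)
  let EB := Equiv.ofBijective _ (key B hB)
  let e : ∀ i, (A i).1 ≃ (B i).1 := fun i => Finset.equivOfCardEq ((A i).2.trans (B i).2.symm)
  let E := (EA.symm.trans (Equiv.sigmaCongrRight e)).trans EB
  refine ⟨E.extendSubtype, fun i => ?_⟩
  refine eq_of_subset_of_card_le (fun b hb => ?_) (by rw [card_map, (A i).2, (B i).2])
  obtain ⟨a, ha, rfl⟩ := mem_map.1 hb
  have h1 : EA ⟨i, a, ha⟩ = ⟨a, i, ha⟩ := rfl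
  have h2 : E ⟨a, i, ha⟩ = EB ⟨i, e i ⟨a, ha⟩⟩ := by
    simp only [E, Equiv.trans_apply, ← h1, Equiv.symm_apply_apply, Equiv.sigmaCongrRight_apply]
  rw [Equiv.coe_toEmbedding, Equiv.extendSubtype_apply_of_mem E a ⟨i, ha⟩, h2]
  exact (e i ⟨a, ha⟩).2

/-- The permutation of the `k`-subsets induced by a permutation of the points. -/
def KSubset.permHom (Ω : Type*) (k : ℕ) : Equiv.Perm Ω →* Equiv.Perm (KSubset Ω k) :=
  MonoidHom.mk' (fun σ => σ.finsetCongr.subtypeEquiv fun A => by simp) fun σ τ =>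
    Equiv.ext fun A =>
      Subtype.ext (Finset.map_map τ.toEmbedding σ.toEmbedding A.1).symm

theorem KSubset.permHom_apply {Ω : Type*} {k : ℕ} (σ : Equiv.Perm Ω) (A : KSubset Ω k) :
    (KSubset.permHom Ω k σ A).1 = A.1.map σ.toEmbedding := rfl

/-! ### Flags, residues and chambers -/

namespace kneserGeometry

variable {n k r : ℕ}

theorem inc_of_ne {x y : KneserElem n k r} (h : (kneserGeometry n k r).inc x y) (hxy : x ≠ y) :
    x.1 ≠ y.1 ∧ Disjoint x.2.1 y.2.1 := h.resolve_left hxy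

theorem inc_iff {x y : KneserElem n k r} (h : x.1 ≠ y.1) :
    (kneserGeometry n k r).inc x y ↔ Disjoint x.2.1 y.2.1 :=
  ⟨fun hi => (inc_of_ne hi fun e => h (e ▸ rfl)).2, fun hd => Or.inr ⟨h, hd⟩⟩

open Classical in
/-- The points in no element of `F`. -/
noncomputable def freePoints (F : Set (KneserElem n k r)) : Finset (KneserPoints n k r) :=
  {a | ∀ x ∈ F, a ∉ x.2.1}

theorem mem_freePoints {F : Set (KneserElem n k r)} {a : KneserPoints n k r} :
    a ∈ freePoints F ↔ ∀ x ∈ F, a ∉ x.2.1 := by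
  simp [freePoints]

theorem mem_residueTypes {F : Set (KneserElem n k r)} {i : Fin r} :
    i ∈ (kneserGeometry n k r).residueTypes F ↔ ∀ x ∈ F, x.1 ≠ i := by
  change (¬ ∃ x, x ∈ F ∧ x.1 = i) ↔ _
  simp only [not_exists, not_and, ne_eq]

theorem mem_residueElems {F : Set (KneserElem n k r)} {x : KneserElem n k r} :
    x ∈ (kneserGeometry n k r).residueElems F ↔
      x.1 ∈ (kneserGeometry n k r).residueTypes F ∧ x.2.1 ⊆ freePoints F := by
  rw [mem_residueTypes]
  constructor
  · rintro ⟨h, hx⟩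
    have hne : ∀ y ∈ F, x ≠ y := fun y hy e => hx (e ▸ hy)
    refine ⟨fun y hy e => (inc_of_ne (h y hy) (hne y hy)).1 e.symm, fun a ha => ?_⟩
    rw [mem_freePoints]
    exact fun y hy => disjoint_left.1 (inc_of_ne (h y hy) (hne y hy)).2 ha
  · rintro ⟨h, hx⟩
    refine ⟨fun y hy => Or.inr ⟨(h y hy).symm, ?_⟩, fun hxF => h x hxF rfl⟩
    exact disjoint_left.2 fun a ha => mem_freePoints.1 (hx ha) y hy

/-- The blocks of a flag are disjoint and have distinct types, so they cover k(r - ρ) points, where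
ρ is the rank of the residue. The term 2k is kept on the left to avoid truncated subtraction. -/
theorem card_freePoints (hr : 2 ≤ r) {F : Set (KneserElem n k r)}
    (hF : (kneserGeometry n k r).IsFlag F) :
    #(freePoints F) + 2 * k = n + k * ((kneserGeometry n k r).residueTypes F).ncard := by
  classical
  have h1 : (freePoints F)ᶜ = F.toFinset.biUnion fun x => x.2.1 := by
    ext a
    simp [mem_freePoints]
  have hinj : Set.InjOn (kneserGeometry n k r).typ F := fun x hx y hy h =>
    (kneserGeometry n k r).eq_of_inc x y (hF x hx y hy) h
  have h2 : #(F.toFinset.biUnion fun x => x.2.1) = F.ncard * k := by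
    rw [card_biUnion, Finset.sum_const_nat (m := k) fun x _ => x.2.2, Set.ncard_eq_toFinset_card']
    intro x hx y hy hxy
    rw [Set.coe_toFinset] at hx hy
    exact (inc_of_ne (hF x hx y hy) hxy).2
  have h3 := card_compl_add_card (freePoints F)
  have h4 := Set.ncard_add_ncard_compl ((kneserGeometry n k r).flagType F)
  have h5 : ((kneserGeometry n k r).flagType F).ncard = F.ncard := hinj.ncard_image
  rw [h1, h2, Fintype.card_fin] at h3
  rw [Nat.card_fin, h5] at h4
  change _ = n + k * ((kneserGeometry n k r).flagType F)ᶜ.ncard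
  obtain ⟨r, rfl⟩ := Nat.exists_eq_add_of_le hr
  rw [Nat.add_sub_cancel_left] at h3
  have h6 : k * (F.ncard + ((kneserGeometry n k (2 + r)).flagType F)ᶜ.ncard) = k * (2 + r) := by
    rw [h4]
  linarith [h3, h6]

theorem isGeometry (hn : 2 * k ≤ n) (hr : 2 ≤ r) : (kneserGeometry n k r).IsGeometry := by
  classical
  intro F hF
  have hc := card_freePoints hr hF
  set J := (kneserGeometry n k r).residueTypes F with hJ
  -- One injection into the free points cuts out all missing blocks at once, disjointly.
  obtain ⟨e⟩ := Function.Embedding.nonempty_of_card_le (α := J × Fin k) (β := freePoints F) (by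
    rw [Fintype.card_prod, Fintype.card_fin, Fintype.card_coe, ← Nat.card_eq_fintype_card,
      Nat.card_coe_set_eq, mul_comm]
    omega)
  let b : J → KSubset (KneserPoints n k r) k := fun i =>
    ⟨univ.map ⟨fun j => (e (i, j)).1, fun j j' h => by simpa using h⟩, by simp⟩
  have hb : ∀ i, (b i).1 ⊆ freePoints F := by
    intro i a ha
    obtain ⟨j, -, rfl⟩ := mem_map.1 ha
    exact (e (i, j)).2
  have hbb : ∀ i j, i ≠ j → Disjoint (b i).1 (b j).1 := by
    intro i j hij
    rw [disjoint_left]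
    rintro a ha ha'
    obtain ⟨s, -, rfl⟩ := mem_map.1 ha
    obtain ⟨t, -, h⟩ := mem_map.1 ha'
    have := e.injective (Subtype.ext h)
    exact hij (congrArg Prod.fst this).symm
  have hFb : ∀ i : J, ((i.1, b i) : KneserElem n k r) ∈ (kneserGeometry n k r).residueElems F :=
    fun i => mem_residueElems.2 ⟨i.2, hb i⟩
  refine ⟨F ∪ Set.range fun i : J => (i.1, b i), ⟨?_, ?_⟩, Set.subset_union_left⟩
  · rintro x (hx | ⟨i, rfl⟩) y (hy | ⟨j, rfl⟩)
    · exact hF x hx y hy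
    · exact (kneserGeometry n k r).inc_symm _ _ ((hFb j).1 x hx)
    · exact (hFb i).1 y hy
    · rcases eq_or_ne i j with rfl | hij
      · exact Or.inl rfl
      · exact Or.inr ⟨fun h => hij (Subtype.ext h), hbb i j hij⟩
  · refine Set.eq_univ_of_forall fun i => ?_
    by_cases hi : i ∈ J
    · exact ⟨_, Or.inr ⟨⟨i, hi⟩, rfl⟩, rfl⟩
    · obtain ⟨x, hx, rfl⟩ := Set.notMem_compl_iff.1 hi
      exact ⟨x, Or.inl hx, rfl⟩

theorem rank_residue (F : Set (KneserElem n k r)) :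
    ((kneserGeometry n k r).residue F).rank = ((kneserGeometry n k r).residueTypes F).encard := rfl

theorem encard_residueElems (hr : 2 ≤ r) {F : Set (KneserElem n k r)}
    (hF : (kneserGeometry n k r).IsFlag F) {i : Fin r}
    (hi : (kneserGeometry n k r).residueTypes F = {i}) :
    ((kneserGeometry n k r).residueElems F).encard = ((n - k).choose k : ℕ) := by
  have hc := card_freePoints hr hF
  rw [hi, Set.ncard_singleton] at hc
  have h1 : #(freePoints F) = n - k := by omega
  rw [← h1, ← KSubset.card_filter_subset, ← Set.encard_coe_eq_coe_finsetCard]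
  have h2 : (kneserGeometry n k r).residueElems F = Prod.mk i ''
      ((({D | D.1 ⊆ freePoints F} : Finset (KSubset (KneserPoints n k r) k)) : Set _)) := by
    ext ⟨j, A⟩
    rw [mem_residueElems, hi]
    simp [and_comm, eq_comm]
  rw [h2]
  exact (Prod.mk_right_injective i).encard_image _

theorem isFirm (hk : 1 ≤ k) (hn : 2 * k + 1 ≤ n) (hr : 2 ≤ r) : (kneserGeometry n k r).IsFirm := by
  intro F hF h1
  rw [rank_residue, Set.encard_eq_one] at h1
  obtain ⟨i, hi⟩ := h1
  rw [encard_residueElems hr hF hi]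
  have h2 : (k + 1).choose k ≤ (n - k).choose k := Nat.choose_le_choose _ (by omega)
  rw [Nat.choose_succ_self_right] at h2
  exact_mod_cast (by omega : 2 ≤ (n - k).choose k)

theorem isThick (hk : 1 ≤ k) (hn : 2 * k + 1 ≤ n) (hr : 2 ≤ r) (h3 : ¬ (n = 3 ∧ k = 1)) :
    (kneserGeometry n k r).IsThick := by
  intro F hF h1
  rw [rank_residue, Set.encard_eq_one] at h1
  obtain ⟨i, hi⟩ := h1
  rw [encard_residueElems hr hF hi]
  have h2 : (k + 1).choose k ≤ (n - k).choose k := Nat.choose_le_choose _ (by omega)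
  rw [Nat.choose_succ_self_right] at h2
  refine mod_cast (?_ : 3 ≤ (n - k).choose k)
  -- For k = 1 the residue has n - 1 elements, and n ≠ 3; for k ≥ 2 the bound k + 1 suffices.
  rcases hk.eq_or_lt with rfl | hk'
  · rw [Nat.choose_one_right]; omega
  · omega

theorem encard_typ_eq (i : Fin r) :
    {x | (kneserGeometry n k r).typ x = i}.encard = ((n + k * (r - 2)).choose k : ℕ) := by
  have h1 := KSubset.card_filter_subset (k := k) (univ : Finset (KneserPoints n k r))
  rw [card_univ, Fintype.card_fin] at h1
  rw [← h1, ← Set.encard_coe_eq_coe_finsetCard]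
  have h2 : {x | (kneserGeometry n k r).typ x = i} = Prod.mk i ''
      ((({D | D.1 ⊆ univ} : Finset (KSubset (KneserPoints n k r) k)) : Set _)) := by
    ext ⟨j, A⟩
    simp [kneserGeometry, eq_comm]
  rw [h2]
  exact (Prod.mk_right_injective i).encard_image _

/-! ### Flag-transitivity and the automorphism groups -/

/-- The action of permutations of the points and of the types on the elements. -/
def permHom (n k r : ℕ) :
    Equiv.Perm (KneserPoints n k r) × Equiv.Perm (Fin r) →* Equiv.Perm (KneserElem n k r) :=
  MonoidHom.mk' (fun p => Equiv.prodCongr p.2 (KSubset.permHom _ k p.1)) fun p q => by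
    rw [Prod.fst_mul, map_mul]
    rfl

theorem permHom_apply (p : Equiv.Perm (KneserPoints n k r) × Equiv.Perm (Fin r))
    (x : KneserElem n k r) : permHom n k r p x = (p.2 x.1, KSubset.permHom _ k p.1 x.2) := rfl

theorem permHom_mem_aut (p : Equiv.Perm (KneserPoints n k r) × Equiv.Perm (Fin r)) :
    permHom n k r p ∈ (kneserGeometry n k r).aut := by
  refine ⟨⟨p.2, fun x => rfl⟩, fun x y => ?_, fun x y => p.2.injective.eq_iff.symm⟩
  refine or_congr (permHom n k r p).injective.eq_iff.symm (and_congr p.2.injective.ne_iff.symm ?_)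
  simp only [permHom_apply, KSubset.permHom_apply, disjoint_map]

theorem permHom_mem_autI (σ : Equiv.Perm (KneserPoints n k r)) :
    permHom n k r (σ, 1) ∈ (kneserGeometry n k r).autI :=
  ⟨permHom_mem_aut _, fun _ => rfl⟩

theorem exists_blocks {C : Set (KneserElem n k r)} (hC : (kneserGeometry n k r).IsChamber C) :
    ∃ A : Fin r → KSubset (KneserPoints n k r) k,
      (Pairwise fun i j => Disjoint (A i).1 (A j).1) ∧ ∀ x ∈ C, x.2 = A x.1 := by
  have h : ∀ i, ∃ A, ((i, A) : KneserElem n k r) ∈ C := by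
    intro i
    obtain ⟨⟨j, A⟩, hx, rfl⟩ : i ∈ (kneserGeometry n k r).flagType C := hC.2 ▸ Set.mem_univ i
    exact ⟨A, hx⟩
  choose A hA using h
  refine ⟨A, fun i j hij => (inc_iff (x := (i, A i)) (y := (j, A j)) hij).1
    (hC.1 _ (hA i) _ (hA j)), fun x hx => ?_⟩
  exact congrArg Prod.snd ((kneserGeometry n k r).eq_of_inc _ _ (hC.1 x hx _ (hA x.1)) rfl)

/-- After extension to chambers, a permutation of Ω matching blocks type by type also matches the
subflags, which have equal type. -/
theorem isFlagTransitive (hn : 2 * k ≤ n) (hr : 2 ≤ r) :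
    (kneserGeometry n k r).IsFlagTransitive := by
  rintro J F G hF hG rfl hFG
  obtain ⟨C, hC, hFC⟩ := isGeometry hn hr F hF
  obtain ⟨D, hD, hGD⟩ := isGeometry hn hr G hG
  obtain ⟨A, hA, hCA⟩ := exists_blocks hC
  obtain ⟨B, hB, hDB⟩ := exists_blocks hD
  obtain ⟨σ, hσ⟩ := KSubset.exists_perm_of_pairwise_disjoint hA hB
  refine ⟨permHom n k r (σ, 1), permHom_mem_autI σ, ?_⟩
  have key : ∀ x ∈ F, ∀ y ∈ G, x.1 = y.1 → permHom n k r (σ, 1) x = y := by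
    intro x hx y hy hxy
    refine Prod.ext hxy (Subtype.ext ?_)
    rw [permHom_apply, KSubset.permHom_apply, hCA x (hFC hx), hDB y (hGD hy), ← hxy]
    exact hσ x.1
  ext y
  constructor
  · rintro ⟨x, hx, rfl⟩
    obtain ⟨y, hy, hyx⟩ : x.1 ∈ (kneserGeometry n k r).flagType G := hFG ▸ ⟨x, hx, rfl⟩
    rwa [key x hx y hy hyx.symm]
  · intro hy
    obtain ⟨x, hx, hxy⟩ : y.1 ∈ (kneserGeometry n k r).flagType F := hFG ▸ ⟨y, hy, rfl⟩
    exact ⟨x, hx, key x hx y hy hxy⟩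

theorem exists_permHom_eq (hk : 1 ≤ k) (hn : 2 * k + 1 ≤ n) (hr : 2 ≤ r)
    {α : Equiv.Perm (KneserElem n k r)} (hα : α ∈ (kneserGeometry n k r).autI) :
    ∃ σ, permHom n k r (σ, 1) = α := by
  obtain ⟨⟨-, hα, -⟩, ht⟩ := hα
  have ht' : ∀ x, (α.symm x).1 = x.1 := fun x => by
    have := ht (α.symm x)
    rw [Equiv.apply_symm_apply] at this
    exact this.symm
  let f : Fin r → Equiv.Perm (KSubset (KneserPoints n k r) k) := fun i =>
    { toFun := fun A => (α (i, A)).2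
      invFun := fun A => (α.symm (i, A)).2
      left_inv := fun A => by
        have : ((i, (α (i, A)).2) : KneserElem n k r) = α (i, A) := Prod.ext (ht (i, A)).symm rfl
        change (α.symm (i, (α (i, A)).2)).2 = A
        rw [this, Equiv.symm_apply_apply]
      right_inv := fun A => by
        have : ((i, (α.symm (i, A)).2) : KneserElem n k r) = α.symm (i, A) :=
          Prod.ext (ht' (i, A)).symm rfl
        change (α (i, (α.symm (i, A)).2)).2 = A
        rw [this, Equiv.apply_symm_apply] }
  have hf : ∀ x, α x = (x.1, f x.1 x.2) := fun x => Prod.ext (ht x) rfl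
  have hpair : ∀ i j, i ≠ j → ∃ σ : Equiv.Perm (KneserPoints n k r), ∀ A,
      (f i A).1 = A.1.map σ.toEmbedding ∧ (f j A).1 = A.1.map σ.toEmbedding := by
    intro i j hij
    refine IsKneserPair.exists_perm hk (by rw [Fintype.card_fin]; omega) fun A B => ?_
    have := hα (i, A) (j, B)
    rwa [inc_iff (x := (i, A)) (y := (j, B)) hij, hf, hf, inc_iff hij] at this
  obtain ⟨σ, hσ⟩ := hpair ⟨0, by omega⟩ ⟨1, by omega⟩ (by simp)
  refine ⟨σ, Equiv.ext fun x => ?_⟩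
  rw [hf]
  refine Prod.ext rfl (Subtype.ext ?_)
  rw [permHom_apply, KSubset.permHom_apply]
  -- Comparing any other type with type 0 shows that all components of `α` agree, hence one `σ`
  -- serves every type.
  rcases eq_or_ne x.1 ⟨0, by omega⟩ with h | h
  · rw [h]
    exact (hσ x.2).1.symm
  · obtain ⟨τ, hτ⟩ := hpair ⟨0, by omega⟩ x.1 h.symm
    exact (hσ x.2).1.symm.trans ((hτ x.2).1.trans (hτ x.2).2.symm)

theorem permHom_injective (hk : 1 ≤ k) (hn : k + 1 ≤ n) (hr : 2 ≤ r) :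
    Function.Injective (permHom n k r) := by
  classical
  rw [injective_iff_map_eq_one]
  rintro ⟨σ, τ⟩ h
  have h' : ∀ (i : Fin r) (A : KSubset (KneserPoints n k r) k),
      τ i = i ∧ A.1.map σ.toEmbedding = A.1 := fun i A => by
    have := congrArg (fun α => α ((i, A) : KneserElem n k r)) h
    simp only [permHom_apply, Equiv.Perm.coe_one, id, Prod.mk.injEq] at this
    exact ⟨this.1, congrArg Subtype.val this.2⟩
  obtain ⟨A₀, -, hA₀⟩ := exists_subset_card_eq (s := (univ : Finset (KneserPoints n k r))) (n := k)
    (by rw [card_univ, Fintype.card_fin]; omega)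
  have hτ : τ = 1 := Equiv.ext fun i => (h' i ⟨A₀, hA₀⟩).1
  subst hτ
  refine Prod.ext (Equiv.ext fun a => ?_) rfl
  by_contra hne
  -- If `σ` moves `a`, a k-set containing `a` but not `σ a` is not fixed.
  obtain ⟨A, hA, hAc⟩ := exists_subsuperset_card_eq (n := k) (s := {a})
    (t := (univ : Finset (KneserPoints n k r)).erase (σ a))
    (by simpa [eq_comm] using hne) (by simpa using hk)
    (by rw [card_erase_of_mem (mem_univ _), card_univ, Fintype.card_fin]; omega)
  have h1 : σ a ∈ A := by
    have := (h' ⟨0, by omega⟩ ⟨A, hAc.2⟩).2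
    simp only at this
    rw [← this]
    exact mem_map_of_mem _ (singleton_subset_iff.1 hA)
  exact (mem_erase.1 (hAc.1 h1)).1 rfl

theorem nonempty_autI_mulEquiv (hk : 1 ≤ k) (hn : 2 * k + 1 ≤ n) (hr : 2 ≤ r) :
    Nonempty ((kneserGeometry n k r).autI ≃* Equiv.Perm (KneserPoints n k r)) := by
  let φ := (permHom n k r).comp (MonoidHom.inl _ _)
  have hφ : Function.Injective φ :=
    (permHom_injective hk (by omega) hr).comp (Prod.mk_left_injective 1)
  have hrange : φ.range = (kneserGeometry n k r).autI := by
    ext α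
    constructor
    · rintro ⟨σ, rfl⟩
      exact permHom_mem_autI σ
    · exact fun hα => exists_permHom_eq hk hn hr hα
  exact ⟨((MonoidHom.ofInjective hφ).trans (MulEquiv.subgroupCongr hrange)).symm⟩

theorem nonempty_aut_mulEquiv (hk : 1 ≤ k) (hn : 2 * k + 1 ≤ n) (hr : 2 ≤ r) :
    Nonempty ((kneserGeometry n k r).aut ≃*
      Equiv.Perm (KneserPoints n k r) × Equiv.Perm (Fin r)) := by
  have hrange : (permHom n k r).range = (kneserGeometry n k r).aut := by
    ext α
    constructor
    · rintro ⟨p, rfl⟩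
      exact permHom_mem_aut p
    · intro hα
      obtain ⟨β, hβ⟩ := hα.1
      -- Undoing the type permutation of `α` reduces to the type-preserving case.
      have h1 : permHom n k r (1, β⁻¹) * α ∈ (kneserGeometry n k r).autI := by
        refine ⟨mul_mem (permHom_mem_aut _) hα, fun x => ?_⟩
        change β⁻¹ ((kneserGeometry n k r).typ (α x)) = _
        rw [hβ, Equiv.Perm.inv_def, Equiv.symm_apply_apply]
      obtain ⟨σ, hσ⟩ := exists_permHom_eq hk hn hr h1
      refine ⟨(1, β⁻¹)⁻¹ * (σ, 1), ?_⟩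
      rw [map_mul, hσ, map_inv, inv_mul_cancel_left]
  exact ⟨((MonoidHom.ofInjective (permHom_injective hk (by omega) hr)).trans
    (MulEquiv.subgroupCongr hrange)).symm⟩

end kneserGeometry

/-! ### Intermediate k-sets and short cycles -/

/-- Exchange min(d, |A \ B|) points of `A \ B` for as many of `B \ A`. Staying inside `A ∪ B` keeps
the new set among the free points. -/
theorem Finset.exists_card_sdiff_le {Ω : Type*} [DecidableEq Ω] {k d e : ℕ} {A B : Finset Ω}
    (hA : #A = k) (hB : #B = k) (h : #(A \ B) ≤ e + d) :
    ∃ C ⊆ A ∪ B, #C = k ∧ #(A \ C) ≤ d ∧ #(C \ B) ≤ e := by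
  have h1 := card_sdiff_add_card_inter A B
  have h2 := card_sdiff_add_card_inter B A
  rw [inter_comm B A] at h2
  obtain ⟨P, hP, hPc⟩ := exists_subset_card_eq (s := A \ B) (n := min d #(A \ B)) (by simp)
  obtain ⟨Q, hQ, hQc⟩ := exists_subset_card_eq (s := B \ A) (n := min d #(A \ B)) (by omega)
  have hPA : P ⊆ A := hP.trans sdiff_subset
  have hd : Disjoint (A \ P) Q := disjoint_left.2 fun x hx hx' =>
    (mem_sdiff.1 (hQ hx')).2 (mem_sdiff.1 hx).1
  have h3 := card_le_card hPA
  refine ⟨A \ P ∪ Q, union_subset_union sdiff_subset (hQ.trans sdiff_subset), ?_, ?_, ?_⟩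
  · rw [card_union_of_disjoint hd, card_sdiff_of_subset hPA]
    omega
  · have : A \ (A \ P ∪ Q) ⊆ P := fun x hx => by
      simp only [mem_sdiff, mem_union, not_or, not_and, not_not] at hx
      exact hx.2.1 hx.1
    have := card_le_card this
    omega
  · have h4 : (A \ P ∪ Q) \ B ⊆ (A \ B) \ P := fun x hx => by
      simp only [mem_sdiff, mem_union] at hx ⊢
      rcases hx.1 with hx' | hx'
      · exact ⟨⟨hx'.1, hx.2⟩, hx'.2⟩
      · exact absurd (mem_sdiff.1 (hQ hx')).1 hx.2
    have h5 := card_le_card h4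
    rw [card_sdiff_of_subset hP] at h5
    omega

theorem SimpleGraph.egirth_le_four {V : Type*} {G : SimpleGraph V} {a b c d : V} (hab : G.Adj a b)
    (hbc : G.Adj b c) (hcd : G.Adj c d) (hda : G.Adj d a) (hac : a ≠ c) (hbd : b ≠ d) :
    G.egirth ≤ 4 := by
  have : (Walk.cons hab (.cons hbc (.cons hcd (.cons hda .nil)))).IsCycle := by
    simp only [Walk.cons_isCycle_iff, Walk.cons_isPath_iff, Walk.IsPath.nil, Walk.support_cons,
      Walk.support_nil, Walk.edges_cons, Walk.edges_nil, List.mem_cons, List.not_mem_nil, or_false,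
      Sym2.eq_iff, true_and]
    have := hab.ne; have := hbc.ne; have := hcd.ne; have := hda.ne
    grind
  exact egirth_le_length this

theorem SimpleGraph.egirth_le_six {V : Type*} {G : SimpleGraph V} {a b c d e f : V}
    (hab : G.Adj a b) (hbc : G.Adj b c) (hcd : G.Adj c d) (hde : G.Adj d e) (hef : G.Adj e f)
    (hfa : G.Adj f a) (h : [a, b, c, d, e, f].Nodup) : G.egirth ≤ 6 := by
  have : (Walk.cons hab (.cons hbc (.cons hcd (.cons hde (.cons hef (.cons hfa .nil)))))).IsCycle := by
    simp only [Walk.cons_isCycle_iff, Walk.cons_isPath_iff, Walk.IsPath.nil, Walk.support_cons,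
      Walk.support_nil, Walk.edges_cons, Walk.edges_nil, List.mem_cons, List.not_mem_nil, or_false,
      Sym2.eq_iff, true_and]
    simp only [List.nodup_cons, List.mem_cons, List.not_mem_nil, or_false, not_or] at h
    grind
  exact egirth_le_length this

theorem SimpleGraph.Walk.IsCycle.exists_of_length_eq_four {V : Type*} {G : SimpleGraph V} {a : V}
    {w : G.Walk a a} (hw : w.IsCycle) (h : w.length = 4) :
    ∃ b c d, G.Adj a b ∧ G.Adj b c ∧ G.Adj c d ∧ G.Adj d a ∧ a ≠ c ∧ b ≠ d := by
  match w, h with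
  | .cons (v := b) hab (.cons (v := c) hbc (.cons (v := d) hcd (.cons hda .nil))), _ =>
    refine ⟨b, c, d, hab, hbc, hcd, hda, ?_, ?_⟩
    all_goals
      rintro rfl
      simp [Walk.cons_isCycle_iff, Walk.cons_isPath_iff] at hw

/-! ### Distances in residues -/

namespace kneserGeometry

variable {n k r : ℕ} {F : Set (KneserElem n k r)}

/-- The incidence graph of the residue of `F`. -/
abbrev residueGraph (F : Set (KneserElem n k r)) :
    SimpleGraph ((kneserGeometry n k r).residueElems F) :=
  ((kneserGeometry n k r).residue F).incidenceGraph

theorem residueGraph_adj {x y : (kneserGeometry n k r).residueElems F} :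
    (residueGraph F).Adj x y ↔ x.1.1 ≠ y.1.1 ∧ Disjoint x.1.2.1 y.1.2.1 := by
  constructor
  · rintro ⟨hne, h⟩
    exact inc_of_ne h (Subtype.coe_ne_coe.2 hne)
  · rintro h
    exact ⟨fun e => h.1 (e ▸ rfl), Or.inr h⟩

theorem typ_mem (x : (kneserGeometry n k r).residueElems F) :
    x.1.1 ∈ (kneserGeometry n k r).residueTypes F := (mem_residueElems.1 x.2).1

theorem subset_freePoints (x : (kneserGeometry n k r).residueElems F) :
    x.1.2.1 ⊆ freePoints F := (mem_residueElems.1 x.2).2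

/-- The element `(i, A)` of the residue of `F`. -/
def residueMk {i : Fin r} (hi : i ∈ (kneserGeometry n k r).residueTypes F)
    (A : KSubset (KneserPoints n k r) k) (hA : A.1 ⊆ freePoints F) :
    (kneserGeometry n k r).residueElems F := ⟨(i, A), mem_residueElems.2 ⟨hi, hA⟩⟩

theorem exists_avoiding {B : Finset (KneserPoints n k r)} (h : k + #B ≤ #(freePoints F)) :
    ∃ D : KSubset (KneserPoints n k r) k, D.1 ⊆ freePoints F ∧ Disjoint B D.1 := by
  have h1 := le_card_sdiff B (freePoints F)
  obtain ⟨D, hD, hDc⟩ := exists_subset_card_eq (s := freePoints F \ B) (n := k) (by omega)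
  exact ⟨⟨D, hDc⟩, hD.trans sdiff_subset, disjoint_of_subset_right hD disjoint_sdiff⟩

/-- Two steps through a common neighbour of type `j` can exchange `d` points: the old and new sets
together cover at most k + d points, leaving k free for the neighbour. -/
theorem edist_le_even {d m : ℕ} (hd : 2 * k + d ≤ #(freePoints F)) {j : Fin r}
    (hj : j ∈ (kneserGeometry n k r).residueTypes F)
    (x y : (kneserGeometry n k r).residueElems F) (hxj : x.1.1 ≠ j) (hxy : x.1.1 = y.1.1)
    (h : #(x.1.2.1 \ y.1.2.1) ≤ m * d) :
    (residueGraph F).edist x y ≤ (2 * m : ℕ) := by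
  induction m generalizing x with
  | zero =>
    obtain rfl : x = y := by
      refine Subtype.ext (Prod.ext hxy (Subtype.ext ?_))
      refine eq_of_subset_of_card_le ?_ (by rw [x.1.2.2, y.1.2.2])
      rw [← sdiff_eq_empty_iff_subset, ← card_eq_zero]
      omega
    simp
  | succ m ih =>
    obtain ⟨C, hC, hCk, hAC, hCB⟩ := exists_card_sdiff_le x.1.2.2 y.1.2.2
      (h.trans (Nat.succ_mul m d).le)
    have hCF : C ⊆ freePoints F :=
      hC.trans (union_subset (subset_freePoints x) (subset_freePoints y))
    have hU : #(x.1.2.1 ∪ C) ≤ k + d := by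
      have h1 := card_sdiff_add_card x.1.2.1 C
      omega
    obtain ⟨D, hDF, hD⟩ := exists_avoiding (F := F) (B := x.1.2.1 ∪ C) (by omega)
    rw [disjoint_union_left] at hD
    let z := residueMk (typ_mem x) ⟨C, hCk⟩ hCF
    let t := residueMk hj D hDF
    have h1 : (residueGraph F).Adj x t := residueGraph_adj.2 ⟨hxj, hD.1⟩
    have h2 : (residueGraph F).Adj t z := residueGraph_adj.2 ⟨hxj.symm, hD.2.symm⟩
    have h3 := ih z hxj hxy hCB
    calc (residueGraph F).edist x y
        ≤ (residueGraph F).edist x t + ((residueGraph F).edist t z + (residueGraph F).edist z y) :=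
          SimpleGraph.edist_triangle.trans (add_le_add_right SimpleGraph.edist_triangle _)
      _ ≤ 1 + (1 + (2 * m : ℕ)) := by
          rw [SimpleGraph.edist_eq_one_iff_adj.2 h1, SimpleGraph.edist_eq_one_iff_adj.2 h2]
          gcongr
      _ = (2 * (m + 1) : ℕ) := by push_cast; ring

/-- For different types, step from `y` to a neighbour of the type of `x` and apply the even case. -/
theorem edist_le {d m : ℕ} (hd : 2 * k + d ≤ #(freePoints F)) (hm : k ≤ m * d)
    (h2 : ((kneserGeometry n k r).residueTypes F).Nontrivial)
    (x y : (kneserGeometry n k r).residueElems F) :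
    (residueGraph F).edist x y ≤ (2 * m + 1 : ℕ) := by
  have hle : ∀ A B : KSubset (KneserPoints n k r) k, #(A.1 \ B.1) ≤ m * d := fun A B =>
    (card_le_card sdiff_subset).trans (A.2.le.trans hm)
  by_cases hxy : x.1.1 = y.1.1
  · obtain ⟨j, hj, hjx⟩ := h2.exists_ne x.1.1
    exact (edist_le_even hd hj x y hjx.symm hxy (hle _ _)).trans (by norm_cast; omega)
  · obtain ⟨D, hDF, hD⟩ := exists_avoiding (F := F) (B := y.1.2.1) (by rw [y.1.2.2]; omega)
    let z := residueMk (typ_mem x) D hDF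
    have h1 : (residueGraph F).Adj z y := residueGraph_adj.2 ⟨hxy, hD.symm⟩
    refine (SimpleGraph.edist_triangle (v := z)).trans ?_
    rw [SimpleGraph.edist_eq_one_iff_adj.2 h1]
    push_cast
    gcongr
    exact_mod_cast edist_le_even hd (typ_mem y) x z hxy rfl (hle _ _)

theorem isResiduallyConnected (hn : 2 * k + 1 ≤ n) (hr : 2 ≤ r) :
    (kneserGeometry n k r).IsResiduallyConnected := by
  intro F hF h2
  rw [rank_residue] at h2
  have h3 : ((kneserGeometry n k r).residueTypes F).Nontrivial := by
    rw [← Set.one_lt_encard_iff_nontrivial]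
    exact lt_of_lt_of_le (by norm_num) h2
  have hc := card_freePoints hr hF
  have h4 := Set.one_lt_ncard_iff_nontrivial.2 h3
  have h5 : 2 * k + 1 ≤ #(freePoints F) := by nlinarith
  obtain ⟨i, hi⟩ := h3.nonempty
  obtain ⟨D, hDF, -⟩ := exists_avoiding (F := F) (B := ∅) (by rw [card_empty]; omega)
  have : Nonempty ((kneserGeometry n k r).residueElems F) := ⟨residueMk hi D hDF⟩
  refine ⟨fun x y => ?_⟩
  rw [← SimpleGraph.edist_ne_top_iff_reachable]
  exact ne_top_of_le_ne_top (ENat.natCast_ne_top _)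
    -- Rank at least two leaves at least n ≥ 2k + 1 free points, so exchanging one point at a time
    -- is possible and k exchanges suffice.
    (edist_le h5 (m := k) (by omega) h3 x y)

/-! ### Rank-two residues: diameter and girth -/

section RankTwo

variable {i j : Fin r}

theorem card_freePoints_of_rank_two (hr : 2 ≤ r) (hF : (kneserGeometry n k r).IsFlag F)
    (hij : i ≠ j) (h : (kneserGeometry n k r).residueTypes F = {i, j}) :
    #(freePoints F) = n := by
  have hc := card_freePoints hr hF
  rw [h, Set.ncard_pair hij] at hc
  omega

theorem typ_eq_of_ne (h : (kneserGeometry n k r).residueTypes F = {i, j})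
    {x y z : (kneserGeometry n k r).residueElems F} (hxy : x.1.1 ≠ y.1.1) (hxz : x.1.1 ≠ z.1.1) :
    y.1.1 = z.1.1 := by
  have hx := typ_mem x
  have hy := typ_mem y
  have hz := typ_mem z
  rw [h] at hx hy hz
  simp only [Set.mem_insert_iff, Set.mem_singleton_iff] at hx hy hz
  grind

/-- The converse of the distance bounds, with parity recording bipartiteness. If `x` and `z` are
disjoint, at most `d` free points lie outside both, so `y \ x` exceeds `y ∩ z` by at most `d`
points, while `y ∩ x` lies in `y \ z`. -/
theorem walk_length (h : (kneserGeometry n k r).residueTypes F = {i, j}) {d : ℕ}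
    (hd : #(freePoints F) ≤ 2 * k + d) {x y : (kneserGeometry n k r).residueElems F}
    (w : (residueGraph F).Walk x y) :
    (x.1.1 = y.1.1 → ∃ q, w.length = 2 * q ∧ #(y.1.2.1 \ x.1.2.1) ≤ q * d) ∧
    (x.1.1 ≠ y.1.1 → ∃ q, w.length = 2 * q + 1 ∧ #(y.1.2.1 ∩ x.1.2.1) ≤ q * d) := by
  induction w with
  | nil => exact ⟨fun _ => ⟨0, by simp⟩, fun h => absurd rfl h⟩
  | @cons x z y hxz w ih =>
    rw [residueGraph_adj] at hxz
    constructor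
    · intro hxy
      obtain ⟨q, hq, hc⟩ := ih.2 (hxy ▸ hxz.1.symm)
      refine ⟨q + 1, by rw [SimpleGraph.Walk.length_cons]; omega, ?_⟩
      have h1 : y.1.2.1 \ x.1.2.1 ⊆
          (y.1.2.1 ∩ z.1.2.1) ∪ (freePoints F \ (x.1.2.1 ∪ z.1.2.1)) := by
        intro a ha
        have := subset_freePoints y (mem_sdiff.1 ha).1
        simp only [mem_sdiff, mem_union, mem_inter] at ha ⊢
        tauto
      have h2 := (card_le_card h1).trans (card_union_le _ _)
      rw [card_sdiff_of_subset (union_subset (subset_freePoints x) (subset_freePoints z)),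
        card_union_of_disjoint hxz.2, x.1.2.2, z.1.2.2] at h2
      rw [Nat.succ_mul]
      omega
    · intro hxy
      obtain ⟨q, hq, hc⟩ := ih.1 (typ_eq_of_ne h hxz.1 hxy)
      refine ⟨q, by rw [SimpleGraph.Walk.length_cons]; omega, (card_le_card ?_).trans hc⟩
      intro a ha
      rw [mem_inter] at ha
      exact mem_sdiff.2 ⟨ha.1, disjoint_left.1 hxz.2 ha.2⟩

theorem residueDiameter_eq (hn : 2 * k + 1 ≤ n) (hr : 2 ≤ r)
    (hF : (kneserGeometry n k r).IsFlag F) (hij : i ≠ j)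
    (h : (kneserGeometry n k r).residueTypes F = {i, j}) :
    (kneserGeometry n k r).residueDiameter F i =
      (2 * ⌈(k : ℚ) / ((n : ℚ) - 2 * (k : ℚ))⌉₊ + 1 : ℕ) := by
  have hU := card_freePoints_of_rank_two hr hF hij h
  obtain ⟨d, rfl⟩ := Nat.exists_eq_add_of_le (show 2 * k ≤ n by omega)
  have hd : (0 : ℚ) < d := by exact_mod_cast (by omega : 0 < d)
  have e : ((2 * k + d : ℕ) : ℚ) - 2 * (k : ℚ) = d := by push_cast; ring
  rw [e]
  have key : ∀ q : ℕ, ⌈(k : ℚ) / d⌉₊ ≤ q ↔ k ≤ q * d := fun q => by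
    rw [Nat.ceil_le, div_le_iff₀ hd]
    exact_mod_cast Iff.rfl
  have hi : i ∈ (kneserGeometry (2 * k + d) k r).residueTypes F := by simp [h]
  have hj : j ∈ (kneserGeometry (2 * k + d) k r).residueTypes F := by simp [h]
  apply le_antisymm
  · refine iSup_le fun x => iSup_le fun _ => iSup_le fun y => ?_
    exact edist_le hU.ge ((key _).1 le_rfl) ⟨i, hi, j, hj, hij⟩ x y
  -- The extremal pair is the same set `D` in both types: its intersection with itself has k points.
  · obtain ⟨D, hDF, -⟩ := exists_avoiding (F := F) (B := ∅) (by rw [card_empty]; omega)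
    refine le_iSup_of_le (residueMk hi D hDF) (le_iSup_of_le rfl
      (le_iSup_of_le (residueMk hj D hDF) (le_iInf fun w => ?_)))
    obtain ⟨q, hq, hc⟩ := (walk_length h hU.le w).2 hij
    change #(D.1 ∩ D.1) ≤ _ at hc
    rw [inter_self, D.2] at hc
    rw [hq]
    have := (key q).2 hc
    exact_mod_cast (by omega)

theorem not_isGeneralizedDigon (hk : 1 ≤ k) (hn : k ≤ n) (hr : 2 ≤ r)
    (hF : (kneserGeometry n k r).IsFlag F) (hij : i ≠ j)
    (h : (kneserGeometry n k r).residueTypes F = {i, j}) :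
    ¬ ((kneserGeometry n k r).residue F).IsGeneralizedDigon := by
  have hU := card_freePoints_of_rank_two hr hF hij h
  have hi : i ∈ (kneserGeometry n k r).residueTypes F := by simp [h]
  have hj : j ∈ (kneserGeometry n k r).residueTypes F := by simp [h]
  obtain ⟨D, hDF, -⟩ := exists_avoiding (F := F) (B := ∅) (by rw [card_empty]; omega)
  intro hdig
  have h1 := (inc_iff (x := (i, D)) (y := (j, D)) hij).1
    (hdig (residueMk hi D hDF) (residueMk hj D hDF) fun e => hij (congrArg Subtype.val e))
  have h2 := D.2
  rw [disjoint_self.1 h1, bot_eq_empty, card_empty] at h2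
  omega

theorem four_le_egirth (h : (kneserGeometry n k r).residueTypes F = {i, j}) :
    4 ≤ (residueGraph F).egirth := by
  rw [SimpleGraph.le_egirth]
  intro a w hw
  -- Only the parity is needed, so `d` is chosen to make the size hypothesis trivial.
  obtain ⟨q, hq, -⟩ := (walk_length h (d := #(freePoints F)) (by omega) w).1 rfl
  have := hw.three_le_length
  exact_mod_cast (by omega : 4 ≤ w.length)

/-- Two disjoint (k + 1)-sets fit; deleting two different points from each gives the four vertices.
-/
theorem egirth_eq_four (hk : 1 ≤ k) (hn : 2 * k + 2 ≤ n) (hr : 2 ≤ r)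
    (hF : (kneserGeometry n k r).IsFlag F) (hij : i ≠ j)
    (h : (kneserGeometry n k r).residueTypes F = {i, j}) : (residueGraph F).egirth = 4 := by
  have hU := card_freePoints_of_rank_two hr hF hij h
  have hi : i ∈ (kneserGeometry n k r).residueTypes F := by simp [h]
  have hj : j ∈ (kneserGeometry n k r).residueTypes F := by simp [h]
  refine le_antisymm ?_ (four_le_egirth h)
  obtain ⟨P, hP, hPc⟩ := exists_subset_card_eq (s := freePoints F) (n := k + 1) (by omega)
  obtain ⟨Q, hQ, hQc⟩ := exists_subset_card_eq (s := freePoints F \ P) (n := k + 1) (by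
    rw [card_sdiff_of_subset hP]; omega)
  have hPQ : Disjoint P Q := disjoint_of_subset_right hQ disjoint_sdiff
  obtain ⟨a, ha, b, hb, hab⟩ := one_lt_card.1 (by omega : 1 < #P)
  obtain ⟨c, hc, d, hd, hcd⟩ := one_lt_card.1 (by omega : 1 < #Q)
  have mk : ∀ {R : Finset (KneserPoints n k r)} {x}, #R = k + 1 → x ∈ R → #(R.erase x) = k :=
    fun hR hx => by rw [card_erase_of_mem hx, hR, Nat.add_sub_cancel]
  have ne : ∀ {R : Finset (KneserPoints n k r)} {x y}, x ∈ R → x ≠ y → R.erase x ≠ R.erase y :=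
    fun hx hxy e => notMem_erase _ _ (e ▸ mem_erase.2 ⟨hxy, hx⟩)
  have hQ' : Q ⊆ freePoints F := hQ.trans sdiff_subset
  let xa := residueMk hi ⟨_, mk hPc ha⟩ ((erase_subset _ _).trans hP)
  let xb := residueMk hi ⟨_, mk hPc hb⟩ ((erase_subset _ _).trans hP)
  let yc := residueMk hj ⟨_, mk hQc hc⟩ ((erase_subset _ _).trans hQ')
  let yd := residueMk hj ⟨_, mk hQc hd⟩ ((erase_subset _ _).trans hQ')
  have hdis : ∀ x y, Disjoint (P.erase x) (Q.erase y) := fun x y =>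
    disjoint_of_subset_left (erase_subset _ _) (disjoint_of_subset_right (erase_subset _ _) hPQ)
  exact SimpleGraph.egirth_le_four (a := xa) (b := yc) (c := xb) (d := yd)
    (residueGraph_adj.2 ⟨hij, hdis _ _⟩) (residueGraph_adj.2 ⟨hij.symm, (hdis _ _).symm⟩)
    (residueGraph_adj.2 ⟨hij, hdis _ _⟩) (residueGraph_adj.2 ⟨hij.symm, (hdis _ _).symm⟩)
    (fun e => ne ha hab (congrArg (fun x => x.1.2.1) e))
    (fun e => ne hc hcd (congrArg (fun x => x.1.2.1) e))

/-- Cycles are even, so only length 4 must be excluded. Its two vertices on each side have union of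
size at least k + 1, and the two unions are disjoint, which needs 2k + 2 free points. -/
theorem six_le_egirth (hU : #(freePoints F) ≤ 2 * k + 1)
    (h : (kneserGeometry n k r).residueTypes F = {i, j}) : 6 ≤ (residueGraph F).egirth := by
  rw [SimpleGraph.le_egirth]
  intro x w hw
  obtain ⟨q, hq, -⟩ := (walk_length h (d := #(freePoints F)) (by omega) w).1 rfl
  have h3 := hw.three_le_length
  by_contra h6
  have h6' : ¬ 6 ≤ w.length := fun h => h6 (by exact_mod_cast h)
  obtain ⟨y, z, t, hxy, hyz, hzt, htx, hxz, hyt⟩ := hw.exists_of_length_eq_four (by omega)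
  rw [residueGraph_adj] at hxy hyz hzt htx
  have exz : x.1.1 = z.1.1 := typ_eq_of_ne h hxy.1.symm hyz.1
  have eyt : y.1.1 = t.1.1 := typ_eq_of_ne h hxy.1 htx.1.symm
  have hA : x.1.2.1 ≠ z.1.2.1 := fun e => hxz (Subtype.ext (Prod.ext exz (Subtype.ext e)))
  have hB : y.1.2.1 ≠ t.1.2.1 := fun e => hyt (Subtype.ext (Prod.ext eyt (Subtype.ext e)))
  have hlt : ∀ {A B : Finset (KneserPoints n k r)}, #A = k → #B = k → A ≠ B → k < #(A ∪ B) := by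
    intro A B hA hB hne
    by_contra hlt
    have e1 := eq_of_subset_of_card_le (subset_union_left (s₁ := A) (s₂ := B)) (by omega)
    have e2 := eq_of_subset_of_card_le (subset_union_right (s₁ := A) (s₂ := B)) (by omega)
    exact hne (e1.trans e2.symm)
  have h7 := hlt x.1.2.2 z.1.2.2 hA
  have h8 := hlt y.1.2.2 t.1.2.2 hB
  have h9 : Disjoint (x.1.2.1 ∪ z.1.2.1) (y.1.2.1 ∪ t.1.2.1) := by
    rw [disjoint_union_left, disjoint_union_right, disjoint_union_right]
    exact ⟨⟨hxy.2, htx.2.symm⟩, hyz.2.symm, hzt.2⟩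
  have h10 : #(x.1.2.1 ∪ z.1.2.1 ∪ (y.1.2.1 ∪ t.1.2.1)) ≤ #(freePoints F) := card_le_card
    (union_subset (union_subset (subset_freePoints x) (subset_freePoints z))
      (union_subset (subset_freePoints y) (subset_freePoints t)))
  rw [card_union_of_disjoint h9] at h10
  omega

/-- Since n = 3 + 2(k - 1), the free points split into a triple `T` and two (k - 1)-sets `P`, `Q`.
The sets {x} ∪ P and {y} ∪ Q are disjoint for x ≠ y in `T`, and K₃,₃ minus a perfect matching is a
hexagon. -/
theorem egirth_eq_six (hk : 1 ≤ k) (hn : n = 2 * k + 1) (hr : 2 ≤ r)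
    (hF : (kneserGeometry n k r).IsFlag F) (hij : i ≠ j)
    (h : (kneserGeometry n k r).residueTypes F = {i, j}) : (residueGraph F).egirth = 6 := by
  have hU := card_freePoints_of_rank_two hr hF hij h
  have hi : i ∈ (kneserGeometry n k r).residueTypes F := by simp [h]
  have hj : j ∈ (kneserGeometry n k r).residueTypes F := by simp [h]
  refine le_antisymm ?_ (six_le_egirth (by omega) h)
  obtain ⟨T, hT, hTc⟩ := exists_subset_card_eq (s := freePoints F) (n := 3) (by omega)
  obtain ⟨P, hP, hPc⟩ := exists_subset_card_eq (s := freePoints F \ T) (n := k - 1) (by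
    rw [card_sdiff_of_subset hT]; omega)
  obtain ⟨Q, hQ, hQc⟩ := exists_subset_card_eq (s := (freePoints F \ T) \ P) (n := k - 1) (by
    rw [card_sdiff_of_subset hP, card_sdiff_of_subset hT]; omega)
  have hPQ : Disjoint P Q := disjoint_of_subset_right hQ disjoint_sdiff
  have hTP : ∀ x ∈ T, x ∉ P := fun x hx hx' => (mem_sdiff.1 (hP hx')).2 hx
  have hTQ : ∀ x ∈ T, x ∉ Q := fun x hx hx' =>
    (mem_sdiff.1 (mem_sdiff.1 (hQ hx')).1).2 hx
  have hPF : P ⊆ freePoints F := hP.trans sdiff_subset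
  have hQF : Q ⊆ freePoints F := hQ.trans (sdiff_subset.trans sdiff_subset)
  obtain ⟨a, b, c, hab, hac, hbc⟩ := Fintype.two_lt_card_iff.1
    (by rw [Fintype.card_coe]; omega : 2 < Fintype.card T)
  let u (x : T) :=
    residueMk hi ⟨insert x.1 P, by rw [card_insert_of_notMem (hTP x.1 x.2), hPc]; omega⟩
      (insert_subset (hT x.2) hPF)
  let v (x : T) :=
    residueMk hj ⟨insert x.1 Q, by rw [card_insert_of_notMem (hTQ x.1 x.2), hQc]; omega⟩
      (insert_subset (hT x.2) hQF)
  have huv : ∀ x y : T, x ≠ y → (residueGraph F).Adj (u x) (v y) := by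
    intro x y hxy
    refine residueGraph_adj.2 ⟨hij, ?_⟩
    change Disjoint (insert x.1 P) (insert y.1 Q)
    simp only [disjoint_insert_left, disjoint_insert_right, mem_insert, not_or]
    exact ⟨⟨fun e => hxy (Subtype.ext e.symm), hTP y.1 y.2⟩, hTQ x.1 x.2, hPQ⟩
  have huu : ∀ x y : T, x ≠ y → u x ≠ u y := by
    intro x y hxy e
    have h1 : insert x.1 P = insert y.1 P := congrArg (fun x => x.1.2.1) e
    have h2 := mem_insert_self x.1 P
    rw [h1, mem_insert] at h2
    exact h2.elim (fun e => hxy (Subtype.ext e)) (hTP x.1 x.2)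
  have hvv : ∀ x y : T, x ≠ y → v x ≠ v y := by
    intro x y hxy e
    have h1 : insert x.1 Q = insert y.1 Q := congrArg (fun x => x.1.2.1) e
    have h2 := mem_insert_self x.1 Q
    rw [h1, mem_insert] at h2
    exact h2.elim (fun e => hxy (Subtype.ext e)) (hTQ x.1 x.2)
  have huv' : ∀ x y : T, u x ≠ v y := fun x y e =>
    hij (congrArg (fun x => x.1.1) e)
  refine SimpleGraph.egirth_le_six (huv a b hab) (huv c b hbc.symm).symm
    (huv c a hac.symm) (huv b a hab.symm).symm (huv b c hbc)
    (huv a c hac).symm ?_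
  simp only [List.nodup_cons, List.mem_cons, List.not_mem_nil, or_false, not_or, not_false_eq_true,
    List.nodup_nil, and_true]
  refine ⟨⟨huv' _ _, huu _ _ hac, huv' _ _, huu _ _ hab, huv' _ _⟩,
    ⟨(huv' _ _).symm, hvv _ _ hab.symm, (huv' _ _).symm, hvv _ _ hbc⟩,
    ⟨huv' _ _, huu _ _ hbc.symm, huv' _ _⟩,
    ⟨(huv' _ _).symm, hvv _ _ hac⟩, huv' _ _⟩

end RankTwo

/-! ### The diagram and the full theorem -/

theorem isBuekenhoutDiagram (hk : 1 ≤ k) (hn : 2 * k + 1 ≤ n) (hr : 2 ≤ r) :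
    (kneserGeometry n k r).IsBuekenhoutDiagram
      { graph := (⊤ : SimpleGraph (Fin r))
        gonality := fun _ _ => if n = 2 * k + 1 then 3 else 2
        diameter := fun _ _ => 2 * ⌈(k : ℚ) / ((n : ℚ) - 2 * (k : ℚ))⌉₊ + 1
        order := fun _ => (n - k).choose k - 1
        count := fun _ => (n + k * (r - 2)).choose k } where
  adj_iff i j := by
    rw [SimpleGraph.top_adj]
    exact ⟨fun hij => ⟨hij, fun F hF h => not_isGeneralizedDigon hk (by omega) hr hF hij h⟩,
      fun h => h.1⟩
  girth_eq i j hij F hF h := by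
    dsimp only
    split_ifs with hn'
    · exact (egirth_eq_six hk hn' hr hF hij h).trans (by norm_num)
    · exact (egirth_eq_four hk (by omega) hr hF hij h).trans (by norm_num)
  diameter_eq i j hij F hF h := residueDiameter_eq hn hr hF hij h
  order_eq i F hF h := by
    rw [encard_residueElems hr hF h]
    -- Positivity ensures that the subtraction in the order is not truncated.
    have : 0 < (n - k).choose k := Nat.choose_pos (by omega)
    exact_mod_cast (by omega : (n - k).choose k = (n - k).choose k - 1 + 1)
  count_eq i := encard_typ_eq i

end kneserGeometry

theorem mainTheorem1 (n k r : ℕ) (hk : 1 ≤ k) (hn : 2 * k + 1 ≤ n) (hr : 2 ≤ r) :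
    (kneserGeometry n k r).IsGeometry ∧
    (kneserGeometry n k r).rank = r ∧
    (kneserGeometry n k r).IsFirm ∧
    (¬ (n = 3 ∧ k = 1) → (kneserGeometry n k r).IsThick) ∧
    (kneserGeometry n k r).IsResiduallyConnected ∧
    (kneserGeometry n k r).IsFlagTransitive ∧
    Nonempty ((kneserGeometry n k r).autI ≃* Equiv.Perm (KneserPoints n k r)) ∧
    Nonempty ((kneserGeometry n k r).aut ≃*
      Equiv.Perm (KneserPoints n k r) × Equiv.Perm (Fin r)) ∧
    (kneserGeometry n k r).IsBuekenhoutDiagram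
      { graph := (⊤ : SimpleGraph (Fin r))
        gonality := fun _ _ => if n = 2 * k + 1 then 3 else 2
        diameter := fun _ _ => 2 * ⌈(k : ℚ) / ((n : ℚ) - 2 * (k : ℚ))⌉₊ + 1
        order := fun _ => (n - k).choose k - 1
        count := fun _ => (n + k * (r - 2)).choose k } :=
  ⟨kneserGeometry.isGeometry (by omega) hr, by simp [IncidenceSystem.rank],
    kneserGeometry.isFirm hk hn hr, kneserGeometry.isThick hk hn hr,
    kneserGeometry.isResiduallyConnected hn hr, kneserGeometry.isFlagTransitive (by omega) hr,
    kneserGeometry.nonempty_autI_mulEquiv hk hn hr, kneserGeometry.nonempty_aut_mulEquiv hk hn hr,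
    kneserGeometry.isBuekenhoutDiagram hk hn hr⟩
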